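/- Let $X$ be a second countable locally compact Hausdorff space, let $\mathscr P$ be the space of Borel probability measures on $X$ with the Borel $\sigma$-algebra of the narrow topology, let $\beta>0$, $\sigma\in\mathscr P$ and $\alpha:=\beta\sigma$. Let $\mathcal D_\alpha$ be the Dirichlet--Ferguson measure with intensity $\alpha$, i.e. the Borel probability measure on $\mathscr P$ such that, for every finite partition $X=B_1\sqcup\dots\sqcup B_k$ into Borel sets, the law of $(\eta B_1,\dots,\eta B_k)$ under $\mathcal D_\alpha(d\eta)$ is the Dirichlet distribution with parameters $(\alpha B_1,\dots,\alpha B_k)$. (For parameters $a_1,\dots,a_k\ge 0$, not all zero, this is the law of $(G_1,\dots,G_k)/(G_1+\dots+G_k)$, where the $G_i$ are independent, $G_i$ is Gamma distributed with shape $a_i$ and rate $1$ if $a_i>0$, and $G_i=0$ if $a_i=0$.) For multi-indices $\mathbf a\in\mathbb N_0^q$ write $|\mathbf a|=a_1+\dots+a_q$, $\mathbf a!=a_1!\cdots a_q!$ and $\binom{|\mathbf a|}{\mathbf a}=|\mathbf a|!/\mathbf a!$, and let $(\beta)_m=\Gamma(\beta+m)/\Gamma(\beta)$. A $q$-colored partition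 of $\mathbf n\in\mathbb N_0^q$, written $A\vDash\mathbf n$, is a function $A:\mathbb N_0^q\setminus\{0\}\to\mathbb N_0$ with $\sum_{\mathbf a}A(\mathbf a)\,\mathbf a=\mathbf n$. For $\mathbf t=(t_{\mathbf a})_{\mathbf a\le\mathbf n}$ (componentwise order) set $$Z_{\mathbf n}(\mathbf t)=\frac1{\mathbf n!}\sum_{A\vDash\mathbf n}M_{\mathbf n}(A)\prod_{\mathbf a:\,A(\mathbf a)>0}t_{\mathbf a}^{A(\mathbf a)},\qquad M_{\mathbf n}(A)=\mathbf n!\prod_{\mathbf a:\,A(\mathbf a)>0}\frac{\binom{|\mathbf a|}{\mathbf a}^{A(\mathbf a)}}{|\mathbf a|^{A(\mathbf a)}\,A(\mathbf a)!}.$$ Then for all bounded continuous $f_1,\dots,f_q:X\to\mathbb R$ and all $\mathbf n=(n_1,\dots,n_q)\in\mathbb N_0^q$, writing $\eta f=\int f\,d\eta$, the function $\eta\mapsto\prod_{j=1}^q(\eta f_j)^{n_j}$ is $\mathcal D_\alpha$-integrable and $$\int_{\mathscr P}\prod_{j=1}^q(\eta f_j)^{n_j}\,d\mathcal D_\alpha(\eta)=\frac{\mathbf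 n!}{(\beta)_{|\mathbf n|}}\,Z_{\mathbf n}\bigl(\Omega_{\mathbf n}[f_1,\dots,f_q;\alpha]\bigr),\qquad \Omega_{\mathbf n}[f_1,\dots,f_q;\alpha]=\Bigl(\int_X f_1^{h_1}\cdots f_q^{h_q}\,d\alpha\Bigr)_{\mathbf h\le\mathbf n}.$$ -/

import Mathlib

open MeasureTheory BoundedContinuousFunction

noncomputable section

namespace DirichletFergusonMoments

/-! ### Colored partitions and the polynomial `Z_n` -/

/-- The nonzero multi-indices `ℕ₀^q ∖ {0}`. -/
abbrev ColorCount (q : ℕ) : Type := {a : Fin q → ℕ // a ≠ 0}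

/-- The length `|a| = a₁ + ⋯ + a_q` of a multi-index. -/
def length {q : ℕ} (a : Fin q → ℕ) : ℕ := ∑ j, a j

/-- The factorial `a! = a₁! ⋯ a_q!` of a multi-index. -/
def multiFactorial {q : ℕ} (a : Fin q → ℕ) : ℕ := ∏ j, (a j).factorial

/-- `col A = ∑ₐ A(a) a` for a (finitely supported) multiset `A` of nonzero multi-indices. -/
def col {q : ℕ} (A : ColorCount q →₀ ℕ) : Fin q → ℕ :=
  ∑ a ∈ A.support, A a • (a : Fin q → ℕ)

/-- The set of `q`-colored partitions of `n`: the multisets `A` of nonzero multi-indices with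
`col A = n`. (If `col A` is finite then `A` has finite support, so that nothing is lost by working
with finitely supported functions.) -/
def coloredPartitions {q : ℕ} (n : Fin q → ℕ) : Set (ColorCount q →₀ ℕ) := {A | col A = n}

lemma mul_le_of_col {q : ℕ} {n : Fin q → ℕ} {A : ColorCount q →₀ ℕ}
    (hA : A ∈ coloredPartitions n) (a : ColorCount q) (j : Fin q) :
    A a * (a : Fin q → ℕ) j ≤ n j := by
  by_cases ha : a ∈ A.support
  · have h : n j = ∑ b ∈ A.support, A b * (b : Fin q → ℕ) j := by
      have h0 : col A = n := hA
      rw [← h0]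
      simp [col, Finset.sum_apply]
    rw [h]
    exact Finset.single_le_sum (f := fun b : ColorCount q => A b * (b : Fin q → ℕ) j)
      (fun _ _ => Nat.zero_le _) ha
  · simp [Finsupp.notMem_support_iff.mp ha]

lemma coloredPartitions_finite {q : ℕ} (n : Fin q → ℕ) : (coloredPartitions n).Finite := by
  classical
  have hS : {a : ColorCount q | (a : Fin q → ℕ) ≤ n}.Finite :=
    (Set.finite_Iic n).preimage Subtype.val_injective.injOn
  refine ((hS.toFinset.finsupp fun _ => Finset.range (length n + 1)).finite_toSet).subset ?_
  intro A hA
  simp only [Finset.mem_coe, Finset.mem_finsupp_iff]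
  refine ⟨fun a ha => ?_, fun a _ => ?_⟩
  · simp only [Set.Finite.mem_toFinset, Set.mem_ofPred_eq]
    intro j
    have hpos : 0 < A a := Nat.pos_of_ne_zero (Finsupp.mem_support_iff.mp ha)
    exact (Nat.le_mul_of_pos_left _ hpos).trans (mul_le_of_col hA a j)
  · obtain ⟨j, hj⟩ : ∃ j, (a : Fin q → ℕ) j ≠ 0 := by
      by_contra! h
      exact a.2 (funext h)
    have h1 : A a ≤ n j :=
      (Nat.le_mul_of_pos_right _ (Nat.pos_of_ne_zero hj)).trans (mul_le_of_col hA a j)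
    have h2 : n j ≤ length n :=
      Finset.single_le_sum (f := n) (fun _ _ => Nat.zero_le _) (Finset.mem_univ j)
    exact Finset.mem_range.mpr (by omega)

/-- The multinomial coefficient of a colored partition `A` of `n`,
`n! ∏_{a ∈ supp A} binom(|a|; a)^{A(a)} / (|a|^{A(a)} A(a)!)`. -/
def multi {q : ℕ} (n : Fin q → ℕ) (A : ColorCount q →₀ ℕ) : ℝ :=
  (multiFactorial n : ℝ) * ∏ a ∈ A.support,
    ((Nat.multinomial Finset.univ (a : Fin q → ℕ) : ℝ) ^ A a
      / ((length (a : Fin q → ℕ) : ℝ) ^ A a * ((A a).factorial : ℝ)))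

/-- `Z_n(t) = (1 / n!) ∑_{A ⊨ n} multi_n(A) ∏_{a ∈ supp A} t_a^{A(a)}`. Only the entries `t a` with
`a ≤ n` (and `a ≠ 0`) enter. -/
def Z {q : ℕ} (n : Fin q → ℕ) (t : (Fin q → ℕ) → ℝ) : ℝ :=
  1 / (multiFactorial n : ℝ) * ∑ A ∈ (coloredPartitions_finite n).toFinset,
    multi n A * ∏ a ∈ A.support, t (a : Fin q → ℕ) ^ A a

/-- The Pochhammer symbol `(β)_k = Γ(β + k) / Γ(β)` of `β > 0`. -/
def pochhammer (β : ℝ) (k : ℕ) : ℝ := Real.Gamma (β + k) / Real.Gamma β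

/-! ### The Dirichlet distribution and the Dirichlet–Ferguson measure -/

/-- The standard gamma distribution with shape `a ≥ 0` and rate `1`, where shape `0` means the
point mass at `0`. -/
def gammaLaw (a : ℝ) : Measure ℝ :=
  if a = 0 then Measure.dirac 0 else ProbabilityTheory.gammaMeasure a 1

/-- The Dirichlet distribution with parameters `a₁, …, a_k ≥ 0`, not all zero: the law of
`(G₁ / ∑ G_j, …, G_k / ∑ G_j)` for independent `G_i` with `G_i` gamma distributed with
shape `a_i`. If `a_i = 0` then the `i`-th coordinate vanishes almost surely; if all `a_i` are
positive then this is the law on the simplex with density proportional to `∏ x_i ^ (a_i - 1)`. -/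
def dirichletDistribution {k : ℕ} (a : Fin k → ℝ) : Measure (Fin k → ℝ) :=
  (Measure.pi fun i => gammaLaw (a i)).map fun z i => z i / ∑ j, z j

variable {X : Type*} [TopologicalSpace X] [MeasurableSpace X] [OpensMeasurableSpace X]

/-- A Borel measure `D` on the space of probability measures on `X`, with the narrow topology, is
the Dirichlet–Ferguson measure with intensity `α` if for every finite measurable partition
`B₁, …, B_k` of `X` the law of `η ↦ (η B₁, …, η B_k)` under `D` is the Dirichlet distribution
with parameters `α B₁, …, α B_k`. -/
def IsDirichletFerguson (α : Measure X)
    (D : @Measure (ProbabilityMeasure X) (borel (ProbabilityMeasure X))) : Prop :=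
  IsProbabilityMeasure D ∧
  ∀ (k : ℕ) (B : Fin k → Set X), (∀ i, MeasurableSet (B i)) →
    (∀ i j, i ≠ j → Disjoint (B i) (B j)) → (⋃ i, B i) = Set.univ →
    @Measure.map _ _ (borel (ProbabilityMeasure X)) _
        (fun (η : ProbabilityMeasure X) (i : Fin k) => (η : Measure X).real (B i)) D
      = dirichletDistribution fun i => α.real (B i)

/-- The family `Ω_n[f₁, …, f_q; α]` with entries `α(f₁^{h₁} ⋯ f_q^{h_q})`. -/
def Omega {q : ℕ} (f : Fin q → X →ᵇ ℝ) (α : Measure X) (h : Fin q → ℕ) : ℝ :=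
  ∫ x, ∏ j, f j x ^ h j ∂α

end DirichletFergusonMoments

end

/-!
The moment formula is first proved for simple functions `f_j`, all constant on the sets of one
finite partition `B₁, …, B_k`, where it is a statement about the Dirichlet distribution with parameters
`aᵢ = α Bᵢ`, and then extended to bounded measurable functions by dominated convergence, applied
once under `η` and once under `D` (`integrable_integral_prod_of_bounded`).

For independent gamma variables `Gᵢ` with shapes `aᵢ` and sum `S`, a homogeneous polynomial `P` of
degree `m` satisfies `E P(G / S) = E P(G) / (∑ aᵢ)_m`. Indeed `S⁻ᵐ` is a mixture of the exponentials
`e ^ (-t S)`, and tilting the gamma distributions by these only rescales the `Gᵢ`; so the two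
expectations differ by a factor depending on `m` and `∑ aᵢ` alone, which the case of one variable,
where `G / S = 1`, identifies (`lintegral_dirichletDistribution_eq_mul_normalizationConst`,
`ofReal_mul_normalizationConst`).

It remains to see that `E ∏ⱼ Yⱼ ^ nⱼ = n! Z_n(t)` for `Yⱼ = ∑ᵢ sᵢⱼ Gᵢ` and
`t_h = ∑ᵢ aᵢ ∏ⱼ sᵢⱼ ^ hⱼ`.
Behind this is the identity `E exp ⟨x, Y⟩ = ∏ᵢ (1 - ⟨x, sᵢ⟩) ^ (-aᵢ)`, whose logarithm is the power
series with coefficients `binom(|h|; h) t_h / |h|`. Instead of the series, the recurrence that comes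
from differentiating it in one variable is used: integration by parts proves it for the moments
(`gammaMoment_X_mul_divPower`), removing one part from a colored partition proves it for `Z_n`
(`mul_Z_eq_sum`), and together with the value at `n = 0` it determines both sides
(`gammaMoment_divPower`).
-/

noncomputable section

namespace DirichletFergusonMoments

/-! ### Multi-indices -/

section Combinatorics

variable {q : ℕ}

lemma length_add (a b : Fin q → ℕ) : length (a + b) = length a + length b := by
  simp [length, Finset.sum_add_distrib]

lemma length_single (j : Fin q) : length (Pi.single j 1 : Fin q → ℕ) = 1 := by
  simp [length]

lemma length_pos {a : Fin q → ℕ} {j : Fin q} (h : 0 < a j) : 0 < length a :=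
  h.trans_le (Finset.single_le_sum (f := a) (fun _ _ => Nat.zero_le _) (Finset.mem_univ j))

lemma single_le_iff_pos {n : Fin q → ℕ} {j : Fin q} : Pi.single j 1 ≤ n ↔ 0 < n j := by
  constructor
  · intro h
    simpa using! h j
  · intro h k
    by_cases hk : k = j
    · subst hk
      simpa using! h
    · simp [hk]

lemma multiFactorial_ne_zero (n : Fin q → ℕ) : (multiFactorial n : ℝ) ≠ 0 := by
  simp [multiFactorial, Finset.prod_eq_zero_iff, Nat.factorial_ne_zero]

lemma multiFactorial_add_single (n : Fin q → ℕ) (j : Fin q) :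
    multiFactorial (n + Pi.single j 1) = (n j + 1) * multiFactorial n := by
  unfold multiFactorial
  rw [← Finset.mul_prod_erase _ _ (Finset.mem_univ j), ← Finset.mul_prod_erase _ (fun i =>
    (n i).factorial) (Finset.mem_univ j), ← mul_assoc]
  congr 1
  · simp [Nat.factorial_succ]
  · refine Finset.prod_congr rfl fun i hi => ?_
    simp [Finset.ne_of_mem_erase hi]

lemma prod_pow_add_single {M : Type*} [CommMonoid M] (g : Fin q → M) (b : Fin q → ℕ) (j : Fin q) :
    ∏ l, g l ^ (b + Pi.single j 1 : Fin q → ℕ) l = g j * ∏ l, g l ^ b l := by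
  simp only [Pi.add_apply, pow_add, Finset.prod_mul_distrib]
  rw [mul_comm]
  congr 1
  rw [Finset.prod_eq_single j (by intro l _ hl; simp [hl]) (by simp)]
  simp

/-- The multinomial coefficient `binom(|b|; b)` of a multi-index, as a real number. -/
def multinom (b : Fin q → ℕ) : ℝ := Nat.multinomial Finset.univ b

lemma multiFactorial_mul_multinom (b : Fin q → ℕ) :
    (multiFactorial b : ℝ) * multinom b = (length b).factorial := by
  unfold multiFactorial multinom length
  exact_mod_cast Nat.multinomial_spec Finset.univ b

lemma multinom_add_single (b : Fin q → ℕ) (j : Fin q) :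
    ((b j : ℝ) + 1) * multinom (b + Pi.single j 1) = ((length b : ℝ) + 1) * multinom b := by
  have h1 := multiFactorial_mul_multinom b
  have h2 := multiFactorial_mul_multinom (b + Pi.single j 1)
  rw [multiFactorial_add_single, length_add, length_single, Nat.factorial_succ] at h2
  push_cast at h2
  rw [← h1] at h2
  apply mul_left_cancel₀ (multiFactorial_ne_zero b)
  linarith

/-- Pascal's rule for multinomial coefficients. -/
lemma multinom_eq_sum {b : Fin q → ℕ} (hb : b ≠ 0) :
    multinom b = ∑ k, if 0 < b k then multinom (b - Pi.single k 1) else 0 := by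
  obtain ⟨j, hj⟩ : ∃ j, b j ≠ 0 := by
    by_contra! h
    exact hb (funext h)
  have hL : (length b : ℝ) ≠ 0 :=
    Nat.cast_ne_zero.mpr (length_pos (Nat.pos_of_ne_zero hj)).ne'
  apply mul_left_cancel₀ hL
  have hs : (length b : ℝ) * multinom b = ∑ k, (b k : ℝ) * multinom b := by
    rw [← Finset.sum_mul]
    simp [length]
  rw [hs, Finset.mul_sum]
  refine Finset.sum_congr rfl fun k _ => ?_
  split_ifs with hk
  · obtain ⟨c, rfl⟩ : ∃ c, b = c + Pi.single k 1 :=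
      ⟨b - Pi.single k 1, (tsub_add_cancel_of_le (single_le_iff_pos.mpr hk)).symm⟩
    have := multinom_add_single c k
    rw [add_tsub_cancel_right, length_add, length_single]
    simpa using! this
  · simp [Nat.eq_zero_of_not_pos hk]

lemma multinom_zero : multinom (0 : Fin q → ℕ) = 1 := by
  have := multiFactorial_mul_multinom (0 : Fin q → ℕ)
  simpa [multiFactorial, length] using! this

/-- Reindexing of a sum over the multi-indices `b ≤ n` with `b_j > 0` by `b ↦ b - e_j`. -/
lemma sum_Iic_ite_pos {M : Type*} [AddCommMonoid M] (n : Fin q → ℕ) (j : Fin q) (hj : 0 < n j)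
    (g : (Fin q → ℕ) → M) :
    (∑ b ∈ Finset.Iic n, if 0 < b j then g b else 0)
      = ∑ b ∈ Finset.Iic (n - Pi.single j 1), g (b + Pi.single j 1) := by
  have hn : Pi.single j 1 ≤ n := single_le_iff_pos.mpr hj
  rw [← Finset.sum_filter]
  refine Finset.sum_nbij' (fun b => b - Pi.single j 1) (fun b => b + Pi.single j 1) ?_ ?_ ?_ ?_ ?_
  · intro b hb
    simp only [Finset.mem_filter, Finset.mem_Iic] at hb ⊢
    exact tsub_le_tsub_right hb.1 _
  · intro b hb
    simp only [Finset.mem_filter, Finset.mem_Iic] at hb ⊢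
    refine ⟨?_, by simp⟩
    rw [← tsub_add_cancel_of_le hn]
    exact add_le_add_left hb _
  · intro b hb
    simp only [Finset.mem_filter, Finset.mem_Iic] at hb
    exact tsub_add_cancel_of_le (single_le_iff_pos.mpr hb.2)
  · intro b _
    exact add_tsub_cancel_right _ _
  · intro b hb
    simp only [Finset.mem_filter, Finset.mem_Iic] at hb
    rw [tsub_add_cancel_of_le (single_le_iff_pos.mpr hb.2)]

/-! ### The recurrence for the polynomials `Z_n` -/

/-- The monomial `∏ₐ x_a^{A(a)} / A(a)!` of a colored partition `A`. -/
def weight (x : ColorCount q → ℝ) (A : ColorCount q →₀ ℕ) : ℝ :=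
  A.prod fun a k => x a ^ k / (k.factorial : ℝ)

/-- Adding one part `a` to a colored partition. -/
lemma weight_add_single (x : ColorCount q → ℝ) (A : ColorCount q →₀ ℕ) (a : ColorCount q) :
    ((A a : ℝ) + 1) * weight x (A + Finsupp.single a 1) = x a * weight x A := by
  classical
  unfold weight
  rw [Finsupp.prod_of_support_subset (A + Finsupp.single a 1) (s := insert a A.support) ?_ _
      (by simp),
    Finsupp.prod_of_support_subset A (s := insert a A.support) (Finset.subset_insert _ _) _
      (by simp),
    ← Finset.mul_prod_erase _ _ (Finset.mem_insert_self a A.support),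
    ← Finset.mul_prod_erase _ (fun b => x b ^ A b / ((A b).factorial : ℝ))
      (Finset.mem_insert_self a A.support), ← mul_assoc, ← mul_assoc]
  · congr 1
    · have h1 : (((A a).factorial : ℕ) : ℝ) ≠ 0 := Nat.cast_ne_zero.mpr (Nat.factorial_ne_zero _)
      have h2 : ((A a : ℝ) + 1) ≠ 0 := by positivity
      simp only [Finsupp.add_apply, Finsupp.single_eq_same, Nat.factorial_succ]
      push_cast
      field_simp
      ring
    · refine Finset.prod_congr rfl fun b hb => ?_
      simp [(Finset.ne_of_mem_erase hb).symm]
  · intro b hb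
    by_contra h
    simp only [Finset.mem_insert, Finsupp.mem_support_iff, not_or, not_not] at h
    simp [h.2, Ne.symm h.1] at hb

lemma col_add_single (A : ColorCount q →₀ ℕ) (a : ColorCount q) :
    col (A + Finsupp.single a 1) = col A + (a : Fin q → ℕ) := by
  have h (B : ColorCount q →₀ ℕ) : col B = B.sum fun a k => k • (a : Fin q → ℕ) := rfl
  rw [h, h, Finsupp.sum_add_index' (by simp) (by intros; rw [add_smul])]
  simp

/-- The variables in which `Z_n(t)` is the sum of the weights of all colored partitions of `n`. -/
def partVar (t : (Fin q → ℕ) → ℝ) (a : ColorCount q) : ℝ :=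
  multinom (a : Fin q → ℕ) / length (a : Fin q → ℕ) * t a

lemma Z_eq_sum_weight (n : Fin q → ℕ) (t : (Fin q → ℕ) → ℝ) :
    Z n t = ∑ A ∈ (coloredPartitions_finite n).toFinset, weight (partVar t) A := by
  unfold Z
  rw [Finset.mul_sum]
  refine Finset.sum_congr rfl fun A _ => ?_
  unfold multi
  rw [mul_assoc, ← mul_assoc, one_div, inv_mul_cancel₀ (multiFactorial_ne_zero n), one_mul,
    ← Finset.prod_mul_distrib]
  unfold weight Finsupp.prod
  refine Finset.prod_congr rfl fun a _ => ?_
  simp only [partVar, mul_pow, div_pow, multinom]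
  ring

lemma Z_zero (t : (Fin q → ℕ) → ℝ) : Z 0 t = 1 := by
  rw [Z_eq_sum_weight]
  have h : (coloredPartitions_finite (0 : Fin q → ℕ)).toFinset = {0} := by
    ext A
    simp only [Set.Finite.mem_toFinset, Finset.mem_singleton]
    constructor
    · intro hA
      ext a
      by_contra hne
      apply a.2
      funext j
      have := mul_le_of_col hA a j
      simp only [Pi.zero_apply, nonpos_iff_eq_zero, mul_eq_zero] at this
      exact this.resolve_left hne
    · rintro rfl
      simp [coloredPartitions, col]
  rw [h]
  simp [weight]

/-- Counting the parts equal to `a` amounts to removing one of them. -/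
lemma sum_mul_weight (x : ColorCount q → ℝ) (n : Fin q → ℕ) (a : ColorCount q)
    (ha : (a : Fin q → ℕ) ≤ n) :
    ∑ A ∈ (coloredPartitions_finite n).toFinset, (A a : ℝ) * weight x A
      = x a * ∑ A ∈ (coloredPartitions_finite (n - (a : Fin q → ℕ))).toFinset, weight x A := by
  classical
  rw [Finset.mul_sum]
  have h0 : ∑ A ∈ (coloredPartitions_finite n).toFinset, (A a : ℝ) * weight x A
      = ∑ A ∈ (coloredPartitions_finite n).toFinset with A a ≠ 0, (A a : ℝ) * weight x A := by
    rw [Finset.sum_filter_of_ne]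
    intro A _ h h'
    simp [h'] at h
  have hsub (A : ColorCount q →₀ ℕ) (hA : A a ≠ 0) :
      A - Finsupp.single a 1 + Finsupp.single a 1 = A := by
    refine tsub_add_cancel_of_le ?_
    rw [Finsupp.single_le_iff]
    exact Nat.pos_of_ne_zero hA
  rw [h0]
  refine Finset.sum_nbij' (fun A => A - Finsupp.single a 1) (fun A => A + Finsupp.single a 1)
    ?_ ?_ ?_ ?_ ?_
  · intro A hA
    simp only [Finset.mem_filter, Set.Finite.mem_toFinset, coloredPartitions,
      Set.mem_ofPred_eq] at hA ⊢
    have := col_add_single (A - Finsupp.single a 1) a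
    rw [hsub A hA.2, hA.1] at this
    rw [this, add_tsub_cancel_right]
  · intro A hA
    simp only [Finset.mem_filter, Set.Finite.mem_toFinset, coloredPartitions,
      Set.mem_ofPred_eq] at hA ⊢
    rw [col_add_single, hA, tsub_add_cancel_of_le ha]
    simp
  · intro A hA
    exact hsub A (Finset.mem_filter.mp hA).2
  · intro A _
    exact add_tsub_cancel_right _ _
  · intro A hA
    rw [← weight_add_single, hsub A (Finset.mem_filter.mp hA).2]
    congr 1
    have := DFunLike.congr_fun (hsub A (Finset.mem_filter.mp hA).2) a
    rw [Finsupp.add_apply, Finsupp.single_eq_same] at this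
    exact_mod_cast this.symm

/-- The recurrence that determines the `Z_n` together with `Z_0 = 1`. -/
lemma mul_Z_eq_sum (t : (Fin q → ℕ) → ℝ) (n : Fin q → ℕ) (j : Fin q) (hj : 0 < n j) :
    (n j : ℝ) * Z n t = ∑ b ∈ Finset.Iic (n - Pi.single j 1),
      multinom b * t (b + Pi.single j 1) * Z (n - Pi.single j 1 - b) t := by
  classical
  -- Every part of `A` is at most `n`, so `n = col A` becomes a sum over an index set free of `A`.
  have hn (A : ColorCount q →₀ ℕ) (hA : A ∈ (coloredPartitions_finite n).toFinset) :
      (n j : ℝ) = ∑ a ∈ (Finset.Iic n).subtype (· ≠ 0), (A a : ℝ) * ((a : Fin q → ℕ) j : ℝ) := by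
    rw [Set.Finite.mem_toFinset] at hA
    have h0 : col A = n := hA
    have h1 : n j = ∑ a ∈ A.support, A a * (a : Fin q → ℕ) j := by
      rw [← h0]
      simp [col, Finset.sum_apply]
    rw [h1]
    push_cast
    refine Finset.sum_subset (fun a ha => ?_) (fun a _ ha => ?_)
    · simp only [Finset.mem_subtype, Finset.mem_Iic]
      exact fun i => (Nat.le_mul_of_pos_left _ (Nat.pos_of_ne_zero
        (Finsupp.mem_support_iff.mp ha))).trans (mul_le_of_col hA a i)
    · simp [Finsupp.notMem_support_iff.mp ha]
  calc (n j : ℝ) * Z n t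
      = ∑ A ∈ (coloredPartitions_finite n).toFinset, ∑ a ∈ (Finset.Iic n).subtype (· ≠ 0),
          ((a : Fin q → ℕ) j : ℝ) * ((A a : ℝ) * weight (partVar t) A) := by
        rw [Z_eq_sum_weight, Finset.mul_sum]
        refine Finset.sum_congr rfl fun A hA => ?_
        rw [hn A hA, Finset.sum_mul]
        exact Finset.sum_congr rfl fun a _ => by ring
    _ = ∑ a ∈ (Finset.Iic n).subtype (· ≠ 0), ((a : Fin q → ℕ) j : ℝ)
          * (multinom (a : Fin q → ℕ) / length (a : Fin q → ℕ) * t a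
            * Z (n - (a : Fin q → ℕ)) t) := by
        rw [Finset.sum_comm]
        refine Finset.sum_congr rfl fun a ha => ?_
        rw [← Finset.mul_sum, sum_mul_weight _ _ _ (by simpa using ha), ← Z_eq_sum_weight]
        rfl
    _ = ∑ b ∈ Finset.Iic n, if 0 < b j then
          (b j : ℝ) * (multinom b / length b * t b * Z (n - b) t) else 0 := by
        rw [Finset.sum_subtype_eq_sum_filter (s := Finset.Iic n) (p := (· ≠ 0))
          (f := fun b => (b j : ℝ) * (multinom b / length b * t b * Z (n - b) t)),
          Finset.sum_filter]
        refine Finset.sum_congr rfl fun b _ => ?_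
        by_cases hb : 0 < b j
        · have : b ≠ 0 := by
            rintro rfl
            simp at hb
          simp [hb, this]
        · simp [Nat.eq_zero_of_not_pos hb]
    _ = _ := by
        rw [sum_Iic_ite_pos n j hj]
        refine Finset.sum_congr rfl fun b _ => ?_
        -- With `a = b + eⱼ`, the factor `a j * binom(|a|; a) / |a|` is `binom(|b|; b)`.
        have h := multinom_add_single b j
        have hL : (length b : ℝ) + 1 ≠ 0 := by positivity
        have h' : ((b j : ℝ) + 1) * (multinom (b + Pi.single j 1) / ((length b : ℝ) + 1))
            = multinom b := by
          rw [mul_div_assoc', h, mul_div_cancel_left₀ _ hL]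
        rw [length_add, length_single, add_comm b, ← tsub_tsub, add_comm _ b]
        simp only [Pi.add_apply, Pi.single_eq_same]
        push_cast
        rw [← mul_assoc, ← mul_assoc, h']

/-! ### The moment functional of independent gamma variables -/

section MomentFunctional

open MvPolynomial

variable {k : ℕ}

/-- The rising factorial `∏ᵢ aᵢ (aᵢ + 1) ⋯ (aᵢ + mᵢ - 1)`: the moment `E ∏ᵢ Gᵢ ^ mᵢ` of independent
gamma variables `Gᵢ` with shapes `aᵢ`. -/
def risingFactorial (a : Fin k → ℝ) (m : Fin k → ℕ) : ℝ :=
  ∏ i, (ascPochhammer ℝ (m i)).eval (a i)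

lemma risingFactorial_add_single (a : Fin k → ℝ) (m : Fin k → ℕ) (i : Fin k) :
    risingFactorial a (m + Pi.single i 1) = (a i + m i) * risingFactorial a m := by
  unfold risingFactorial
  rw [← Finset.mul_prod_erase _ _ (Finset.mem_univ i), ← Finset.mul_prod_erase _ (fun l =>
    (ascPochhammer ℝ (m l)).eval (a l)) (Finset.mem_univ i), ← mul_assoc]
  congr 1
  · simp [ascPochhammer_succ_eval, mul_comm]
  · refine Finset.prod_congr rfl fun l hl => ?_
    simp [Finset.ne_of_mem_erase hl]

/-- The linear functional `P ↦ E P(G₁, …, G_k)` on polynomials, for independent gamma variables `Gᵢ`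
with shapes `aᵢ`, described by its values on monomials. -/
def gammaMoment (a : Fin k → ℝ) : MvPolynomial (Fin k) ℝ →ₗ[ℝ] ℝ :=
  (basisMonomials (Fin k) ℝ).constr ℝ fun m => risingFactorial a m

lemma gammaMoment_monomial (a : Fin k → ℝ) (m : Fin k →₀ ℕ) (c : ℝ) :
    gammaMoment a (monomial m c) = c * risingFactorial a m := by
  have h : monomial m c = c • basisMonomials (Fin k) ℝ m := by
    simp [smul_monomial]
  rw [h, map_smul, gammaMoment, Module.Basis.constr_basis, smul_eq_mul]

/-- Integration by parts for the gamma distribution. -/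
lemma gammaMoment_X_mul (a : Fin k → ℝ) (i : Fin k) (P : MvPolynomial (Fin k) ℝ) :
    gammaMoment a (X i * P) = a i * gammaMoment a P + gammaMoment a (X i * pderiv i P) := by
  induction P using MvPolynomial.induction_on' with
  | add P Q hP hQ => simp only [mul_add, map_add, hP, hQ]; ring
  | monomial m c =>
    have hX (l : Fin k →₀ ℕ) (d : ℝ) :
        X i * monomial l d = monomial (l + Finsupp.single i 1) d := by
      rw [X, monomial_mul, one_mul, add_comm]
    rw [pderiv_monomial, hX, hX, gammaMoment_monomial, gammaMoment_monomial,
      gammaMoment_monomial, Finsupp.coe_add, Finsupp.single_eq_pi_single,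
      risingFactorial_add_single]
    by_cases hm : m i = 0
    · simp [hm]
      ring
    · rw [tsub_add_cancel_of_le (Finsupp.single_le_iff.mpr (Nat.pos_of_ne_zero hm))]
      ring

/-- The linear form `∑ᵢ sᵢⱼ Xᵢ`. -/
def linForm (s : Fin k → Fin q → ℝ) (j : Fin q) : MvPolynomial (Fin k) ℝ :=
  ∑ i, C (s i j) * X i

/-- The divided power `∏ⱼ (∑ᵢ sᵢⱼ Xᵢ) ^ nⱼ / nⱼ!`. -/
def divPower (s : Fin k → Fin q → ℝ) (n : Fin q → ℕ) : MvPolynomial (Fin k) ℝ :=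
  C (multiFactorial n : ℝ)⁻¹ * ∏ j, linForm s j ^ n j

lemma pderiv_linForm (s : Fin k → Fin q → ℝ) (i : Fin k) (j : Fin q) :
    pderiv i (linForm s j) = C (s i j) := by
  classical
  simp [linForm, pderiv_X, Pi.single_apply]

/-- The Leibniz rule for a finite product. -/
lemma pderiv_prod {ι : Type*} [DecidableEq ι] (i : Fin k) (t : Finset ι)
    (g : ι → MvPolynomial (Fin k) ℝ) :
    pderiv i (∏ j ∈ t, g j) = ∑ l ∈ t, pderiv i (g l) * ∏ j ∈ t.erase l, g j := by
  induction t using Finset.induction_on with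
  | empty => simp
  | insert x t hx ih =>
    rw [Finset.prod_insert hx, Finset.sum_insert hx, Derivation.leibniz, ih,
      Finset.erase_insert hx, smul_eq_mul, smul_eq_mul, add_comm, mul_comm (∏ j ∈ t, g j),
      Finset.mul_sum]
    congr 1
    refine Finset.sum_congr rfl fun l hl => ?_
    have hlx : l ≠ x := fun h => hx (h ▸ hl)
    rw [Finset.erase_insert_of_ne hlx.symm,
      Finset.prod_insert (fun h => hx (Finset.mem_of_mem_erase h))]
    ring

lemma linForm_mul_divPower (s : Fin k → Fin q → ℝ) (n : Fin q → ℕ) (j : Fin q) :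
    linForm s j * divPower s n = C ((n j : ℝ) + 1) * divPower s (n + Pi.single j 1) := by
  have h2 : ((n j : ℝ) + 1) * (multiFactorial (n + Pi.single j 1) : ℝ)⁻¹
      = (multiFactorial n : ℝ)⁻¹ := by
    have h3 : (n j : ℝ) + 1 ≠ 0 := by positivity
    have h4 := multiFactorial_ne_zero n
    rw [multiFactorial_add_single]
    push_cast
    field_simp
  unfold divPower
  rw [prod_pow_add_single, ← mul_assoc (MvPolynomial.C _) (MvPolynomial.C _), ← C_mul, h2]
  ring

lemma pderiv_divPower (s : Fin k → Fin q → ℝ) (n : Fin q → ℕ) (i : Fin k) :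
    pderiv i (divPower s n)
      = ∑ j, if 0 < n j then C (s i j) * divPower s (n - Pi.single j 1) else 0 := by
  classical
  rw [divPower, pderiv_C_mul, pderiv_prod, Finset.mul_sum]
  refine Finset.sum_congr rfl fun j _ => ?_
  rw [Derivation.leibniz_pow, pderiv_linForm]
  split_ifs with hj
  · obtain ⟨c, rfl⟩ : ∃ c, n = c + Pi.single j 1 :=
      ⟨n - Pi.single j 1, (tsub_add_cancel_of_le (single_le_iff_pos.mpr hj)).symm⟩
    have h2 : (multiFactorial (c + Pi.single j 1) : ℝ)⁻¹ * ((c j : ℝ) + 1)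
        = (multiFactorial c : ℝ)⁻¹ := by
      have h3 : (c j : ℝ) + 1 ≠ 0 := by positivity
      have h4 := multiFactorial_ne_zero c
      rw [multiFactorial_add_single]
      push_cast
      field_simp
    rw [add_tsub_cancel_right, divPower, ← Finset.mul_prod_erase _ (fun l =>
      linForm s l ^ c l) (Finset.mem_univ j), ← h2, C_mul]
    have h5 : ∏ l ∈ Finset.univ.erase j, linForm s l ^ (c + Pi.single j 1 : Fin q → ℕ) l
        = ∏ l ∈ Finset.univ.erase j, linForm s l ^ c l := by
      refine Finset.prod_congr rfl fun l hl => ?_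
      simp [Finset.ne_of_mem_erase hl]
    rw [h5]
    simp only [Pi.add_apply, Pi.single_eq_same, add_tsub_cancel_right, nsmul_eq_mul,
      smul_eq_mul, map_add, map_natCast, map_one]
    push_cast
    ring
  · simp [Nat.eq_zero_of_not_pos hj]

/-- One integration by parts lowers the degree `n` in one coordinate; iterating this gives
`gammaMoment_X_mul_divPower`. -/
lemma gammaMoment_X_mul_divPower_step (a : Fin k → ℝ) (s : Fin k → Fin q → ℝ) (i : Fin k)
    (n : Fin q → ℕ) :
    gammaMoment a (X i * divPower s n) = a i * gammaMoment a (divPower s n)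
      + ∑ j, if 0 < n j then s i j * gammaMoment a (X i * divPower s (n - Pi.single j 1))
        else 0 := by
  rw [gammaMoment_X_mul, pderiv_divPower, Finset.mul_sum, map_sum]
  congr 1
  refine Finset.sum_congr rfl fun j _ => ?_
  split_ifs
  · rw [mul_left_comm, ← smul_eq_C_mul, map_smul, smul_eq_mul]
  · simp

/-- The generating function identity `E[Gᵢ exp ⟨x, Y⟩] = aᵢ (1 - ⟨x, sᵢ⟩)⁻¹ E[exp ⟨x, Y⟩]` for
`Y = ∑ᵢ Gᵢ sᵢ`, read off coefficientwise. -/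
lemma gammaMoment_X_mul_divPower (a : Fin k → ℝ) (s : Fin k → Fin q → ℝ) (i : Fin k)
    (n : Fin q → ℕ) :
    gammaMoment a (X i * divPower s n) = a i * ∑ b ∈ Finset.Iic n,
      multinom b * (∏ j, s i j ^ b j) * gammaMoment a (divPower s (n - b)) := by
  induction hN : length n using Nat.strong_induction_on generalizing n with
  | _ N ih =>
  subst hN
  rw [gammaMoment_X_mul_divPower_step]
  -- By induction the `j`-th term is a sum over `b - eⱼ`; it is reindexed to run over `b`.
  have hstep (j : Fin q) : (if 0 < n j then
        s i j * gammaMoment a (X i * divPower s (n - Pi.single j 1)) else 0)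
      = a i * ∑ b ∈ Finset.Iic n, if 0 < b j then
        multinom (b - Pi.single j 1) * (∏ l, s i l ^ b l) * gammaMoment a (divPower s (n - b))
        else 0 := by
    split_ifs with hj
    · have hlen : length (n - Pi.single j 1) < length n := by
        have := length_add (n - Pi.single j 1) (Pi.single j 1)
        rw [tsub_add_cancel_of_le (single_le_iff_pos.mpr hj), length_single] at this
        omega
      rw [ih _ hlen _ rfl, sum_Iic_ite_pos n j hj, mul_left_comm, Finset.mul_sum]
      congr 1
      refine Finset.sum_congr rfl fun b _ => ?_
      rw [prod_pow_add_single, add_tsub_cancel_right, add_comm b, ← tsub_tsub]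
      ring
    · rw [Finset.sum_eq_zero, mul_zero]
      intro b hb
      rw [if_neg]
      have : b j ≤ n j := (Finset.mem_Iic.mp hb) j
      omega
  simp_rw [hstep]
  rw [← Finset.mul_sum, ← mul_add, Finset.sum_comm]
  congr 1
  -- The summand `b = 0` is the boundary term; the others are collected by Pascal's rule.
  have h0 : (0 : Fin q → ℕ) ∈ Finset.Iic n := by simp
  rw [← Finset.add_sum_erase _ _ h0, ← Finset.add_sum_erase (Finset.Iic n) (fun b =>
    multinom b * (∏ j, s i j ^ b j) * gammaMoment a (divPower s (n - b))) h0]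
  simp only [multinom_zero, Pi.zero_apply, pow_zero, Finset.prod_const_one, tsub_zero, one_mul,
    lt_irrefl, if_false, Finset.sum_const_zero, zero_add]
  congr 1
  refine Finset.sum_congr rfl fun b hb => ?_
  rw [multinom_eq_sum (Finset.ne_of_mem_erase hb), Finset.sum_mul, Finset.sum_mul]
  refine Finset.sum_congr rfl fun j _ => ?_
  split_ifs <;> simp

/-- The mixed moments of the linear forms `∑ᵢ sᵢⱼ Gᵢ` are given by the polynomials `Z_n`: both sides
satisfy the same recurrence. -/
lemma gammaMoment_divPower (a : Fin k → ℝ) (s : Fin k → Fin q → ℝ) (n : Fin q → ℕ) :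
    gammaMoment a (divPower s n) = Z n fun h => ∑ i, a i * ∏ j, s i j ^ h j := by
  induction hN : length n using Nat.strong_induction_on generalizing n with
  | _ N ih =>
  subst hN
  by_cases hn : n = 0
  · subst hn
    have h1 : divPower s (0 : Fin q → ℕ) = monomial 0 1 := by
      simp [divPower, multiFactorial]
    rw [h1, gammaMoment_monomial, Z_zero]
    simp [risingFactorial]
  obtain ⟨j, hj⟩ : ∃ j, n j ≠ 0 := by
    by_contra! h
    exact hn (funext h)
  replace hj := Nat.pos_of_ne_zero hj
  have hj' : (n j : ℝ) ≠ 0 := Nat.cast_ne_zero.mpr hj.ne'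
  apply mul_left_cancel₀ hj'
  have hlen := length_add (n - Pi.single j 1) (Pi.single j 1)
  rw [tsub_add_cancel_of_le (single_le_iff_pos.mpr hj), length_single] at hlen
  rw [mul_Z_eq_sum _ _ _ hj]
  have h1 : (n j : ℝ) * gammaMoment a (divPower s n)
      = gammaMoment a (linForm s j * divPower s (n - Pi.single j 1)) := by
    rw [linForm_mul_divPower, tsub_add_cancel_of_le (single_le_iff_pos.mpr hj),
      ← smul_eq_C_mul, map_smul, smul_eq_mul, Pi.sub_apply, Pi.single_eq_same,
      Nat.cast_sub hj]
    simp
  have h2 : gammaMoment a (linForm s j * divPower s (n - Pi.single j 1))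
      = ∑ i, s i j * gammaMoment a (X i * divPower s (n - Pi.single j 1)) := by
    rw [linForm, Finset.sum_mul, map_sum]
    refine Finset.sum_congr rfl fun i _ => ?_
    rw [mul_assoc, ← smul_eq_C_mul, map_smul, smul_eq_mul]
  rw [h1, h2]
  simp_rw [gammaMoment_X_mul_divPower, Finset.mul_sum]
  rw [Finset.sum_comm]
  refine Finset.sum_congr rfl fun b hb => ?_
  have hlen' : length (n - Pi.single j 1 - b) < length n := by
    have := length_add (n - Pi.single j 1 - b) b
    rw [tsub_add_cancel_of_le (Finset.mem_Iic.mp hb)] at this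
    omega
  rw [← ih _ hlen' _ rfl, Finset.sum_mul]
  refine Finset.sum_congr rfl fun i _ => ?_
  rw [prod_pow_add_single]
  ring

lemma divPower_isHomogeneous (s : Fin k → Fin q → ℝ) (n : Fin q → ℕ) :
    (divPower s n).IsHomogeneous (length n) := by
  have h1 (j : Fin q) : (linForm s j).IsHomogeneous 1 :=
    IsHomogeneous.sum _ _ _ fun i _ => by
      simpa using! (isHomogeneous_C (Fin k) (s i j)).mul (isHomogeneous_X ℝ i)
  have h2 : (∏ j, linForm s j ^ n j).IsHomogeneous (∑ j, n j) :=
    IsHomogeneous.prod _ _ _ fun j _ => by simpa using! (h1 j).pow (n j)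
  simpa [divPower, length] using! (isHomogeneous_C (Fin k) _).mul h2

lemma eval_divPower (s : Fin k → Fin q → ℝ) (n : Fin q → ℕ) (y : Fin k → ℝ) :
    eval y (divPower s n) = (multiFactorial n : ℝ)⁻¹ * ∏ j, (∑ i, s i j * y i) ^ n j := by
  simp [divPower, linForm]

end MomentFunctional

end Combinatorics

/-! ### Moments of the Dirichlet distribution -/

lemma Gamma_add_natCast {a : ℝ} (ha : 0 < a) (m : ℕ) :
    Real.Gamma (a + m) = (ascPochhammer ℝ m).eval a * Real.Gamma a := by
  induction m with
  | zero => simp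
  | succ m ih =>
    have : a + m ≠ 0 := by positivity
    rw [ascPochhammer_succ_eval, Nat.cast_succ, ← add_assoc, Real.Gamma_add_one this, ih]
    ring

lemma pochhammer_eq_eval {β : ℝ} (hβ : 0 < β) (m : ℕ) :
    pochhammer β m = (ascPochhammer ℝ m).eval β := by
  rw [pochhammer, Gamma_add_natCast hβ, mul_div_cancel_right₀ _ (Real.Gamma_pos_of_pos hβ).ne']

lemma ascPochhammer_eval_nonneg {a : ℝ} (ha : 0 ≤ a) (m : ℕ) :
    0 ≤ (ascPochhammer ℝ m).eval a := by
  rcases ha.eq_or_lt with rfl | h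
  · rw [ascPochhammer_eval_zero]
    split_ifs <;> norm_num
  · exact (ascPochhammer_pos m a h).le

lemma risingFactorial_nonneg {k : ℕ} (a : Fin k → NNReal) (m : Fin k → ℕ) :
    0 ≤ risingFactorial (fun i => (a i : ℝ)) m :=
  Finset.prod_nonneg fun i _ => ascPochhammer_eval_nonneg (a i).2 _

lemma lintegral_rpow_mul_exp {c r : ℝ} (hc : 0 < c) (hr : 0 < r) :
    ∫⁻ x in Set.Ioi (0 : ℝ), ENNReal.ofReal (x ^ (c - 1) * Real.exp (-(r * x)))
      = ENNReal.ofReal ((1 / r) ^ c * Real.Gamma c) := by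
  have h := Real.integral_rpow_mul_exp_neg_mul_Ioi hc hr
  have hpos : 0 < (1 / r) ^ c * Real.Gamma c :=
    mul_pos (Real.rpow_pos_of_pos (by positivity) _) (Real.Gamma_pos_of_pos hc)
  rw [← h, ofReal_integral_eq_lintegral_ofReal]
  -- The integral is not zero, so the integrand cannot fail to be integrable.
  · by_contra hni
    rw [integral_undef hni] at h
    exact hpos.ne h
  · rw [Filter.EventuallyLE, ae_restrict_iff' measurableSet_Ioi]
    refine ae_of_all _ fun x hx => ?_
    have : 0 < x := hx
    simp only [Pi.zero_apply]
    positivity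

/-- Shapes are taken in `ℝ≥0`, since `gammaLaw` is meaningful for nonnegative shapes only. -/
instance isProbabilityMeasure_gammaLaw (a : NNReal) : IsProbabilityMeasure (gammaLaw a) := by
  unfold gammaLaw
  split_ifs with h
  · infer_instance
  · exact ProbabilityTheory.isProbabilityMeasure_gammaMeasure
      (lt_of_le_of_ne a.2 (Ne.symm h)) one_pos

lemma ae_gammaLaw_of_pos {a : ℝ} (ha : 0 < a) : ∀ᵐ x ∂gammaLaw a, 0 < x := by
  have h1 : MeasurableSet {x : ℝ | ¬ 0 < x} := measurableSet_Ioi.compl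
  rw [gammaLaw, if_neg ha.ne', ae_iff, ProbabilityTheory.gammaMeasure, withDensity_apply _ h1]
  have h2 : {x : ℝ | ¬ 0 < x} = Set.Iic 0 := by
    ext x
    simp
  rw [h2, setLIntegral_congr Iio_ae_eq_Iic.symm]
  exact ProbabilityTheory.lintegral_gammaPDF_of_nonpos le_rfl

lemma ae_gammaLaw_nonneg (a : NNReal) : ∀ᵐ x ∂gammaLaw a, 0 ≤ x := by
  by_cases h : (a : ℝ) = 0
  · rw [gammaLaw, if_pos h, ae_dirac_eq]
    simp
  · exact (ae_gammaLaw_of_pos (lt_of_le_of_ne a.2 (Ne.symm h))).mono fun _ hx => hx.le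

/-- The exponentially tilted moments of the gamma distribution. -/
lemma lintegral_gammaLaw (a : NNReal) (m : ℕ) {t : ℝ} (ht : 0 ≤ t) :
    ∫⁻ x, ENNReal.ofReal (x ^ m * Real.exp (-(t * x))) ∂gammaLaw a
      = ENNReal.ofReal ((ascPochhammer ℝ m).eval (a : ℝ) * (1 + t) ^ (-((a : ℝ) + m))) := by
  by_cases h : (a : ℝ) = 0
  · rw [gammaLaw, if_pos h, lintegral_dirac, h, ascPochhammer_eval_zero]
    by_cases hm : m = 0 <;> simp [hm]
  have ha : 0 < (a : ℝ) := lt_of_le_of_ne a.2 (Ne.symm h)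
  have hG := Real.Gamma_pos_of_pos ha
  rw [gammaLaw, if_neg h, ProbabilityTheory.gammaMeasure,
    lintegral_withDensity_eq_lintegral_mul _ (by unfold ProbabilityTheory.gammaPDF; fun_prop)
      (by fun_prop)]
  have h1 : (ProbabilityTheory.gammaPDF a 1 *
        fun x : ℝ => ENNReal.ofReal (x ^ m * Real.exp (-(t * x))))
      =ᵐ[volume] (Set.Ioi (0 : ℝ)).indicator fun x => ENNReal.ofReal (Real.Gamma a)⁻¹ *
        ENNReal.ofReal (x ^ ((a + m : ℝ) - 1) * Real.exp (-((1 + t) * x))) := by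
    filter_upwards [Measure.ae_ne volume (0 : ℝ)] with x hx
    rcases lt_or_gt_of_ne hx with hx | hx
    · simp [ProbabilityTheory.gammaPDF_of_neg hx, hx.le]
    · have hx' : x ∈ Set.Ioi (0 : ℝ) := hx
      rw [Set.indicator_of_mem hx', Pi.mul_apply,
        ProbabilityTheory.gammaPDF_of_nonneg hx.le, ← ENNReal.ofReal_mul (by positivity),
        ← ENNReal.ofReal_mul (by positivity)]
      congr 1
      have e1 : x ^ ((a + m : ℝ) - 1) = x ^ ((a : ℝ) - 1) * x ^ m := by
        rw [← Real.rpow_natCast x m, ← Real.rpow_add hx]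
        ring_nf
      have e2 : Real.exp (-((1 + t) * x)) = Real.exp (-(1 * x)) * Real.exp (-(t * x)) := by
        rw [← Real.exp_add]
        ring_nf
      rw [e1, e2, Real.one_rpow]
      ring
  rw [lintegral_congr_ae h1, lintegral_indicator measurableSet_Ioi,
    lintegral_const_mul _ (by fun_prop), lintegral_rpow_mul_exp (by positivity) (by positivity),
    ← ENNReal.ofReal_mul (by positivity), Gamma_add_natCast ha]
  congr 1
  rw [one_div, Real.inv_rpow (by positivity), Real.rpow_neg (by positivity)]
  field_simp

section

variable {k : ℕ}

lemma ae_pi_gammaLaw_nonneg (a : Fin k → NNReal) :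
    ∀ᵐ z ∂(Measure.pi fun i => gammaLaw (a i)), ∀ i, 0 ≤ z i := by
  rw [ae_all_iff]
  intro i
  exact (Measure.quasiMeasurePreserving_eval (fun i => gammaLaw (a i)) i).ae
    (ae_gammaLaw_nonneg (a i))

lemma lintegral_pi_gammaLaw (a : Fin k → NNReal) (m : Fin k → ℕ) {t : ℝ} (ht : 0 ≤ t) :
    ∫⁻ z, ENNReal.ofReal ((∏ i, z i ^ m i) * Real.exp (-(t * ∑ i, z i)))
        ∂(Measure.pi fun i => gammaLaw (a i))
      = ENNReal.ofReal (risingFactorial (fun i => (a i : ℝ)) m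
          * (1 + t) ^ (-((∑ i, (a i : ℝ)) + length m))) := by
  have h1 : ∀ᵐ z ∂(Measure.pi fun i => gammaLaw (a i)),
      ENNReal.ofReal ((∏ i, z i ^ m i) * Real.exp (-(t * ∑ i, z i)))
        = ∏ i, ENNReal.ofReal (z i ^ m i * Real.exp (-(t * z i))) := by
    filter_upwards [ae_pi_gammaLaw_nonneg a] with z hz
    rw [← ENNReal.ofReal_prod_of_nonneg, Finset.prod_mul_distrib, ← Real.exp_sum,
      Finset.sum_neg_distrib, Finset.mul_sum]
    intro i _
    have := hz i
    positivity
  have hind : ProbabilityTheory.iIndepFun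
      (fun i (z : Fin k → ℝ) => ENNReal.ofReal (z i ^ m i * Real.exp (-(t * z i))))
      (Measure.pi fun i => gammaLaw (a i)) :=
    ProbabilityTheory.iIndepFun_pi
      (X := fun i (x : ℝ) => ENNReal.ofReal (x ^ m i * Real.exp (-(t * x))))
      fun i => by fun_prop
  rw [lintegral_congr_ae h1,
    ProbabilityTheory.lintegral_prod_eq_prod_lintegral_of_indepFun _ _ hind
      (fun i => by fun_prop)]
  have h2 (i : Fin k) : ∫⁻ z, ENNReal.ofReal (z i ^ m i * Real.exp (-(t * z i)))
        ∂(Measure.pi fun i => gammaLaw (a i))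
      = ENNReal.ofReal ((ascPochhammer ℝ (m i)).eval (a i : ℝ)
        * (1 + t) ^ (-((a i : ℝ) + m i))) := by
    rw [← lintegral_gammaLaw (a i) (m i) ht]
    exact (measurePreserving_eval (fun i => gammaLaw (a i)) i).lintegral_comp
      (f := fun x : ℝ => ENNReal.ofReal (x ^ m i * Real.exp (-(t * x)))) (by fun_prop)
  simp_rw [h2]
  rw [← ENNReal.ofReal_prod_of_nonneg, Finset.prod_mul_distrib, ← Real.rpow_sum_of_pos]
  · congr 3
    simp [length, Finset.sum_add_distrib, add_comm]
  · positivity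
  · intro i _
    exact mul_nonneg (ascPochhammer_eval_nonneg (a i).2 _) (by positivity)

lemma measurable_normalize :
    Measurable fun (z : Fin k → ℝ) (i : Fin k) => z i / ∑ j, z j := by
  fun_prop

instance isProbabilityMeasure_dirichletDistribution (a : Fin k → NNReal) :
    IsProbabilityMeasure (dirichletDistribution fun i => (a i : ℝ)) :=
  Measure.isProbabilityMeasure_map measurable_normalize.aemeasurable

lemma ae_dirichletDistribution_nonneg (a : Fin k → NNReal) :
    ∀ᵐ y ∂dirichletDistribution fun i => (a i : ℝ), ∀ i, 0 ≤ y i := by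
  unfold dirichletDistribution
  rw [ae_map_iff measurable_normalize.aemeasurable]
  · filter_upwards [ae_pi_gammaLaw_nonneg a] with z hz i
    exact div_nonneg (hz i) (Finset.sum_nonneg fun j _ => hz j)
  · simp only [Set.ofPred_forall]
    exact MeasurableSet.iInter fun i => measurableSet_le measurable_const (measurable_pi_apply i)

/-- The factor by which normalization changes the moments of total degree `m` of gamma variables
with total shape `s`: the constant `Γ(m)⁻¹ ∫₀^∞ t ^ (m - 1) (1 + t) ^ (-(s + m)) dt`. -/
def normalizationConst (s : ℝ) (m : ℕ) : ENNReal :=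
  ENNReal.ofReal (Real.Gamma m)⁻¹ * ∫⁻ t in Set.Ioi (0 : ℝ),
    ENNReal.ofReal (t ^ ((m : ℝ) - 1) * (1 + t) ^ (-(s + m)))

/-- Moments of the normalized vector, up to a constant that depends on the total shape and the total
degree only. The power `S⁻ᵐ` of the sum is written as `Γ(m)⁻¹ ∫₀^∞ t ^ (m - 1) e ^ (-t S) dt`. -/
lemma lintegral_dirichletDistribution_eq_mul_normalizationConst (a : Fin k → NNReal) (m : Fin k → ℕ)
    (hm : 0 < length m) :
    ∫⁻ y, ENNReal.ofReal (∏ i, y i ^ m i) ∂dirichletDistribution (fun i => (a i : ℝ))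
      = ENNReal.ofReal (risingFactorial (fun i => (a i : ℝ)) m)
        * normalizationConst (∑ i, (a i : ℝ)) (length m) := by
  have hm' : (0 : ℝ) < length m := Nat.cast_pos.mpr hm
  have hG := Real.Gamma_pos_of_pos hm'
  have h1 : ∀ᵐ z ∂(Measure.pi fun i => gammaLaw (a i)),
      ENNReal.ofReal (∏ i, (z i / ∑ j, z j) ^ m i)
        = ENNReal.ofReal (Real.Gamma (length m))⁻¹ * ∫⁻ t in Set.Ioi (0 : ℝ),
          ENNReal.ofReal (t ^ ((length m : ℝ) - 1)) *
            ENNReal.ofReal ((∏ i, z i ^ m i) * Real.exp (-(t * ∑ i, z i))) := by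
    filter_upwards [ae_pi_gammaLaw_nonneg a] with z hz
    have hP : 0 ≤ ∏ i, z i ^ m i := Finset.prod_nonneg fun i _ => pow_nonneg (hz i) _
    -- If `S = 0`, then all `z i` vanish, and both sides are `0` since some `m i` is positive.
    rcases (Finset.sum_nonneg fun i (_ : i ∈ Finset.univ) => hz i).eq_or_lt with hS | hS
    · have hz0 (i : Fin k) : z i = 0 :=
        (Finset.sum_eq_zero_iff_of_nonneg fun i _ => hz i).mp hS.symm i (Finset.mem_univ i)
      have hne : ∑ i, m i ≠ 0 := hm.ne'
      have hex : ∃ i, m i ≠ 0 := by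
        by_contra! h
        exact hne (Finset.sum_eq_zero fun i _ => h i)
      obtain ⟨i, hi⟩ := hex
      have hprod : ∏ i, (0 : ℝ) ^ m i = 0 :=
        Finset.prod_eq_zero (Finset.mem_univ i) (zero_pow hi)
      simp [hz0, hprod]
    · set S := ∑ j, z j
      have h2 : ∀ t ∈ Set.Ioi (0 : ℝ), ENNReal.ofReal (t ^ ((length m : ℝ) - 1)) *
            ENNReal.ofReal ((∏ i, z i ^ m i) * Real.exp (-(t * S)))
          = ENNReal.ofReal (∏ i, z i ^ m i) *
            ENNReal.ofReal (t ^ ((length m : ℝ) - 1) * Real.exp (-(S * t))) := by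
        intro t ht
        have ht' : 0 < t := ht
        rw [← ENNReal.ofReal_mul (by positivity), ← ENNReal.ofReal_mul hP, mul_comm S t]
        congr 1
        ring
      rw [setLIntegral_congr_fun measurableSet_Ioi h2, lintegral_const_mul _ (by fun_prop),
        lintegral_rpow_mul_exp hm' hS, ← ENNReal.ofReal_mul hP,
        ← ENNReal.ofReal_mul (by positivity)]
      congr 1
      simp only [div_pow, Finset.prod_div_distrib, Finset.prod_pow_eq_pow_sum]
      change _ / S ^ length m = _
      rw [Real.rpow_natCast, one_div, inv_pow]
      field_simp
  unfold dirichletDistribution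
  rw [lintegral_map (by fun_prop) measurable_normalize, lintegral_congr_ae h1,
    lintegral_const_mul' _ _ ENNReal.ofReal_ne_top, lintegral_lintegral_swap (by fun_prop)]
  have h3 : ∀ t ∈ Set.Ioi (0 : ℝ), ∫⁻ z, ENNReal.ofReal (t ^ ((length m : ℝ) - 1)) *
        ENNReal.ofReal ((∏ i, z i ^ m i) * Real.exp (-(t * ∑ i, z i)))
          ∂(Measure.pi fun i => gammaLaw (a i))
      = ENNReal.ofReal (risingFactorial (fun i => (a i : ℝ)) m)
        * ENNReal.ofReal (t ^ ((length m : ℝ) - 1)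
          * (1 + t) ^ (-((∑ i, (a i : ℝ)) + length m))) := by
    intro t ht
    have ht' : 0 < t := ht
    rw [lintegral_const_mul' _ _ ENNReal.ofReal_ne_top, lintegral_pi_gammaLaw a m ht'.le,
      ENNReal.ofReal_mul (risingFactorial_nonneg a m),
      ENNReal.ofReal_mul (by positivity)]
    ring
  rw [setLIntegral_congr_fun measurableSet_Ioi h3,
    lintegral_const_mul' _ _ ENNReal.ofReal_ne_top, normalizationConst]
  ring

/-- The normalization constant is found from a single gamma variable, which normalizes to `1`. -/
lemma ofReal_mul_normalizationConst {s : ℝ} (hs : 0 < s) {m : ℕ} (hm : 0 < m) :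
    ENNReal.ofReal ((ascPochhammer ℝ m).eval s) * normalizationConst s m = 1 := by
  lift s to NNReal using hs.le
  have h := lintegral_dirichletDistribution_eq_mul_normalizationConst (k := 1) (fun _ => s)
    (fun _ => m) (by simpa [length] using! hm)
  have hl : length (fun _ : Fin 1 => m) = m := by simp [length]
  have hr : risingFactorial (fun _ : Fin 1 => (s : ℝ)) (fun _ => m)
      = (ascPochhammer ℝ m).eval (s : ℝ) := by simp [risingFactorial]
  rw [hl, hr] at h
  simp only [Finset.univ_unique, Finset.sum_singleton, Finset.prod_singleton] at h
  rw [← h]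
  unfold dirichletDistribution
  rw [lintegral_map (by fun_prop) measurable_normalize]
  have h1 : ∀ᵐ z ∂(Measure.pi fun _ : Fin 1 => gammaLaw s),
      ENNReal.ofReal ((z default / ∑ j, z j) ^ m) = 1 := by
    have h2 := (Measure.quasiMeasurePreserving_eval (fun _ : Fin 1 => gammaLaw s) default).ae
      (ae_gammaLaw_of_pos hs)
    filter_upwards [h2] with z hz
    have hz' : z default ≠ 0 := ne_of_gt hz
    simp only [Finset.univ_unique, Finset.sum_singleton, div_self hz', one_pow,
      ENNReal.ofReal_one]
  rw [lintegral_congr_ae h1]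
  simp

lemma lintegral_dirichletDistribution (a : Fin k → NNReal) (ha : 0 < ∑ i, (a i : ℝ))
    (m : Fin k → ℕ) :
    ∫⁻ y, ENNReal.ofReal (∏ i, y i ^ m i) ∂dirichletDistribution (fun i => (a i : ℝ))
      = ENNReal.ofReal (risingFactorial (fun i => (a i : ℝ)) m
        / (ascPochhammer ℝ (length m)).eval (∑ i, (a i : ℝ))) := by
  rcases Nat.eq_zero_or_pos (length m) with hm | hm
  · have hm0 (i : Fin k) : m i = 0 := by
      have := Finset.single_le_sum (f := m) (fun _ _ => Nat.zero_le _) (Finset.mem_univ i)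
      unfold length at hm
      omega
    rw [hm]
    simp [hm0, risingFactorial]
  · have hp := ascPochhammer_pos (length m) _ ha
    rw [lintegral_dirichletDistribution_eq_mul_normalizationConst a m hm,
      ENNReal.ofReal_div_of_pos hp, ENNReal.div_eq_inv_mul, mul_comm]
    congr 1
    exact ENNReal.eq_inv_of_mul_eq_one_left
      ((mul_comm _ _).trans (ofReal_mul_normalizationConst ha hm))

lemma integrable_integral_dirichletDistribution (a : Fin k → NNReal)
    (ha : 0 < ∑ i, (a i : ℝ)) (m : Fin k → ℕ) :
    Integrable (fun y : Fin k → ℝ => ∏ i, y i ^ m i)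
        (dirichletDistribution fun i => (a i : ℝ)) ∧
    ∫ y, ∏ i, y i ^ m i ∂dirichletDistribution (fun i => (a i : ℝ))
      = risingFactorial (fun i => (a i : ℝ)) m
        / (ascPochhammer ℝ (length m)).eval (∑ i, (a i : ℝ)) := by
  have h0 : 0 ≤ᵐ[dirichletDistribution fun i => (a i : ℝ)]
      fun y : Fin k → ℝ => ∏ i, y i ^ m i := by
    filter_upwards [ae_dirichletDistribution_nonneg a] with y hy
    exact Finset.prod_nonneg fun i _ => pow_nonneg (hy i) _
  have hmeas : AEStronglyMeasurable (fun y : Fin k → ℝ => ∏ i, y i ^ m i)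
      (dirichletDistribution fun i => (a i : ℝ)) :=
    Measurable.aestronglyMeasurable (by fun_prop)
  have h := lintegral_dirichletDistribution a ha m
  refine ⟨(lintegral_ofReal_ne_top_iff_integrable hmeas h0).mp ?_, ?_⟩
  · rw [h]
    exact ENNReal.ofReal_ne_top
  · rw [integral_eq_lintegral_of_nonneg_ae h0 hmeas, h, ENNReal.toReal_ofReal]
    exact div_nonneg (risingFactorial_nonneg a m) (ascPochhammer_pos _ _ ha).le

/-- Moments of the Dirichlet distribution of homogeneous polynomials, in terms of those of the
independent gamma variables. -/
lemma integrable_integral_eval_dirichletDistribution (a : Fin k → NNReal)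
    (ha : 0 < ∑ i, (a i : ℝ)) {d : ℕ} {P : MvPolynomial (Fin k) ℝ} (hP : P.IsHomogeneous d) :
    Integrable (fun y : Fin k → ℝ => MvPolynomial.eval y P)
        (dirichletDistribution fun i => (a i : ℝ)) ∧
    ∫ y, MvPolynomial.eval y P ∂dirichletDistribution (fun i => (a i : ℝ))
      = gammaMoment (fun i => (a i : ℝ)) P / (ascPochhammer ℝ d).eval (∑ i, (a i : ℝ)) := by
  have h := integrable_integral_dirichletDistribution a ha
  simp_rw [MvPolynomial.eval_eq']
  have hint (m : Fin k →₀ ℕ) (_ : m ∈ P.support) :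
      Integrable (fun y : Fin k → ℝ => P.coeff m * ∏ i, y i ^ m i)
        (dirichletDistribution fun i => (a i : ℝ)) := (h m).1.const_mul _
  refine ⟨integrable_finsetSum _ hint, ?_⟩
  rw [integral_finsetSum _ hint]
  conv_rhs => rw [P.as_sum, map_sum, Finset.sum_div]
  refine Finset.sum_congr rfl fun m hm => ?_
  have hd : length m = d := by
    have := hP (MvPolynomial.mem_support_iff.mp hm)
    rw [← this, Finsupp.weight_apply, Finsupp.sum_fintype _ _ (by simp)]
    simp [length]
  rw [integral_const_mul, (h m).2, gammaMoment_monomial, hd]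
  ring

/-- The moment formula for the Dirichlet distribution. -/
lemma integrable_integral_prod_linForm {q : ℕ} (a : Fin k → NNReal)
    (ha : 0 < ∑ i, (a i : ℝ)) (s : Fin k → Fin q → ℝ) (n : Fin q → ℕ) :
    Integrable (fun y : Fin k → ℝ => ∏ j, (∑ i, s i j * y i) ^ n j)
        (dirichletDistribution fun i => (a i : ℝ)) ∧
    ∫ y, ∏ j, (∑ i, s i j * y i) ^ n j ∂dirichletDistribution (fun i => (a i : ℝ))
      = (multiFactorial n : ℝ) / pochhammer (∑ i, (a i : ℝ)) (length n)
        * Z n fun h => ∑ i, (a i : ℝ) * ∏ j, s i j ^ h j := by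
  have h := integrable_integral_eval_dirichletDistribution a ha (divPower_isHomogeneous s n)
  have hne := multiFactorial_ne_zero n
  have heq (y : Fin k → ℝ) : ∏ j, (∑ i, s i j * y i) ^ n j
      = (multiFactorial n : ℝ) * MvPolynomial.eval y (divPower s n) := by
    rw [eval_divPower, mul_inv_cancel_left₀ hne]
  simp_rw [heq]
  refine ⟨h.1.const_mul _, ?_⟩
  rw [integral_const_mul, h.2, gammaMoment_divPower, pochhammer_eq_eval ha]
  ring

end

/-! ### From simple functions to bounded measurable functions -/

section RandomMeasure

open Filter Topology

variable {X : Type*} [MeasurableSpace X] {q : ℕ}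

/-- The distinct values of a simple function, enumerated by `Fin`; the fibres over them are the sets
of a finite measurable partition. -/
def simpleValue {E : Type*} (F : SimpleFunc X E) (i : Fin F.range.card) : E :=
  F.range.equivFin.symm i

lemma simpleValue_injective {E : Type*} (F : SimpleFunc X E) :
    Function.Injective (simpleValue F) :=
  Subtype.val_injective.comp F.range.equivFin.symm.injective

lemma exists_simpleValue_eq {E : Type*} (F : SimpleFunc X E) (x : X) :
    ∃ i, simpleValue F i = F x :=
  ⟨F.range.equivFin ⟨F x, F.mem_range_self x⟩, by simp [simpleValue]⟩

lemma integral_comp_simpleFunc {E : Type*} (F : SimpleFunc X E) (g : E → ℝ) (μ : Measure X)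
    [IsFiniteMeasure μ] :
    ∫ x, g (F x) ∂μ
      = ∑ i, μ.real (F ⁻¹' {simpleValue F i}) * g (simpleValue F i) := by
  classical
  have h (x : X) : g (F x) = ∑ i,
      (F ⁻¹' {simpleValue F i}).indicator (fun _ => g (simpleValue F i)) x := by
    obtain ⟨i, hi⟩ := exists_simpleValue_eq F x
    rw [Finset.sum_eq_single i]
    · simp [Set.indicator_of_mem, hi]
    · intro l _ hl
      refine Set.indicator_of_notMem (fun hx => hl ?_) _
      exact simpleValue_injective F (hi.trans hx).symm
    · simp
  simp_rw [h]
  rw [integral_finsetSum _ fun i _ => (integrable_const _).indicator (F.measurableSet_preimage _)]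
  refine Finset.sum_congr rfl fun i _ => ?_
  rw [integral_indicator_const _ (F.measurableSet_preimage _), smul_eq_mul]

variable {Ω : Type*} [MeasurableSpace Ω] {P : Measure Ω} {η : Ω → ProbabilityMeasure X}
  {α : Measure X} [IsFiniteMeasure α]

/-- The moment formula for simple functions: the values of the random measure on their common level
sets have a Dirichlet distribution. -/
lemma integrable_integral_prod_simpleFunc
    (hη : ∀ (k : ℕ) (B : Fin k → Set X), (∀ i, MeasurableSet (B i)) →
      (∀ i j, i ≠ j → Disjoint (B i) (B j)) → (⋃ i, B i) = Set.univ →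
      P.map (fun ω i => (η ω : Measure X).real (B i))
        = dirichletDistribution fun i => α.real (B i))
    (hα : 0 < α.real Set.univ) (F : SimpleFunc X (Fin q → ℝ)) (n : Fin q → ℕ) :
    Integrable (fun ω => ∏ j, (∫ x, F x j ∂(η ω : Measure X)) ^ n j) P ∧
    ∫ ω, ∏ j, (∫ x, F x j ∂(η ω : Measure X)) ^ n j ∂P
      = (multiFactorial n : ℝ) / pochhammer (α.real Set.univ) (length n)
        * Z n fun h => ∫ x, ∏ j, F x j ^ h j ∂α := by
  set B : Fin F.range.card → Set X := fun i => F ⁻¹' {simpleValue F i} with hB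
  let a : Fin F.range.card → NNReal := fun i => ⟨α.real (B i), measureReal_nonneg⟩
  have hmap : P.map (fun ω i => (η ω : Measure X).real (B i))
      = dirichletDistribution fun i => (a i : ℝ) := by
    refine hη _ B (fun i => F.measurableSet_preimage _) (fun i l hil => ?_) ?_
    · refine Set.disjoint_left.mpr fun x hx hx' => hil ?_
      exact simpleValue_injective F (Eq.trans (Eq.symm hx) hx')
    · refine Set.eq_univ_of_forall fun x => Set.mem_iUnion.mpr ?_
      obtain ⟨i, hi⟩ := exists_simpleValue_eq F x
      exact ⟨i, hi.symm⟩
  -- The push-forward along a map that is not a.e. measurable would vanish.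
  have hmeas : AEMeasurable (fun ω i => (η ω : Measure X).real (B i)) P := by
    have : NeZero (P.map (fun ω i => (η ω : Measure X).real (B i))) := by
      rw [hmap]
      infer_instance
    exact aemeasurable_of_map_neZero this
  have hsum : ∑ i, (a i : ℝ) = α.real Set.univ := by
    have := integral_comp_simpleFunc F (fun _ => 1) α
    simpa using! this.symm
  have h := integrable_integral_prod_linForm a (hsum ▸ hα) (fun i => simpleValue F i) n
  have hF (ω : Ω) : ∏ j, (∫ x, F x j ∂(η ω : Measure X)) ^ n j
      = ∏ j, (∑ i, simpleValue F i j * (η ω : Measure X).real (B i)) ^ n j := by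
    refine Finset.prod_congr rfl fun j _ => ?_
    rw [integral_comp_simpleFunc F (fun v => v j)]
    simp_rw [mul_comm, hB]
  have hZ (h : Fin q → ℕ) : ∫ x, ∏ j, F x j ^ h j ∂α
      = ∑ i, (a i : ℝ) * ∏ j, simpleValue F i j ^ h j :=
    integral_comp_simpleFunc F (fun v => ∏ j, v j ^ h j) α
  simp_rw [hF, hZ, ← hsum]
  rw [← hmap] at h
  have hφ : AEStronglyMeasurable
      (fun y : Fin F.range.card → ℝ => ∏ j, (∑ i, simpleValue F i j * y i) ^ n j)
      (P.map (fun ω i => (η ω : Measure X).real (B i))) :=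
    Measurable.aestronglyMeasurable (by fun_prop)
  exact ⟨(integrable_map_measure hφ hmeas).mp h.1, (integral_map hmeas hφ).symm.trans h.2⟩

lemma tendsto_Z (n : Fin q → ℕ) {u : ℕ → (Fin q → ℕ) → ℝ} {t : (Fin q → ℕ) → ℝ}
    (h : ∀ b, Tendsto (fun N => u N b) atTop (𝓝 (t b))) :
    Tendsto (fun N => Z n (u N)) atTop (𝓝 (Z n t)) := by
  unfold Z
  exact (tendsto_finsetSum _ fun A _ => (tendsto_finsetProd _ fun a _ =>
    (h _).pow _).const_mul _).const_mul _

/-- The moment formula for bounded measurable functions, by approximation with simple functions. -/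
lemma integrable_integral_prod_of_bounded [IsProbabilityMeasure P]
    (hη : ∀ (k : ℕ) (B : Fin k → Set X), (∀ i, MeasurableSet (B i)) →
      (∀ i j, i ≠ j → Disjoint (B i) (B j)) → (⋃ i, B i) = Set.univ →
      P.map (fun ω i => (η ω : Measure X).real (B i))
        = dirichletDistribution fun i => α.real (B i))
    (hα : 0 < α.real Set.univ) {f : X → Fin q → ℝ} (hf : Measurable f) {C : ℝ}
    (hC : ∀ x, ‖f x‖ ≤ C) (n : Fin q → ℕ) :
    Integrable (fun ω => ∏ j, (∫ x, f x j ∂(η ω : Measure X)) ^ n j) P ∧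
    ∫ ω, ∏ j, (∫ x, f x j ∂(η ω : Measure X)) ^ n j ∂P
      = (multiFactorial n : ℝ) / pochhammer (α.real Set.univ) (length n)
        * Z n fun h => ∫ x, ∏ j, f x j ^ h j ∂α := by
  let F (N : ℕ) : SimpleFunc X (Fin q → ℝ) :=
    SimpleFunc.approxOn f hf Set.univ 0 (Set.mem_univ _) N
  have hlim (x : X) : Tendsto (fun N => F N x) atTop (𝓝 (f x)) :=
    SimpleFunc.tendsto_approxOn hf _ (by simp)
  have hlim' (x : X) (j : Fin q) : Tendsto (fun N => F N x j) atTop (𝓝 (f x j)) :=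
    (tendsto_pi_nhds.mp (hlim x)) j
  have hbd (N : ℕ) (x : X) (j : Fin q) : |F N x j| ≤ C + C :=
    (norm_le_pi_norm (F N x) j).trans ((SimpleFunc.norm_approxOn_zero_le hf _ x N).trans
      (add_le_add (hC x) (hC x)))
  have hmeas (N : ℕ) (j : Fin q) : Measurable fun x => F N x j :=
    (measurable_pi_apply j).comp (F N).measurable
  have hS (N : ℕ) := integrable_integral_prod_simpleFunc hη hα (F N) n
  have hint (N : ℕ) (j : Fin q) (μ : Measure X) [IsProbabilityMeasure μ] :
      |∫ x, F N x j ∂μ| ≤ C + C := by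
    have := norm_integral_le_of_norm_le_const (μ := μ) (f := fun x => F N x j) (C := C + C)
      (ae_of_all _ fun x => hbd N x j)
    simpa using! this
  have hbdω (N : ℕ) (ω : Ω) :
      ‖∏ j, (∫ x, F N x j ∂(η ω : Measure X)) ^ n j‖ ≤ ∏ j, (C + C) ^ n j := by
    rw [Real.norm_eq_abs, Finset.abs_prod]
    refine Finset.prod_le_prod (fun _ _ => abs_nonneg _) fun j _ => ?_
    rw [abs_pow]
    exact pow_le_pow_left₀ (abs_nonneg _) (hint N j _) _
  have hlimω (ω : Ω) : Tendsto (fun N => ∏ j, (∫ x, F N x j ∂(η ω : Measure X)) ^ n j) atTop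
      (𝓝 (∏ j, (∫ x, f x j ∂(η ω : Measure X)) ^ n j)) := by
    refine tendsto_finsetProd _ fun j _ => Tendsto.pow ?_ _
    exact tendsto_integral_of_dominated_convergence (fun _ => C + C)
      (fun N => (hmeas N j).aestronglyMeasurable) (integrable_const _)
      (fun N => ae_of_all _ fun x => hbd N x j) (ae_of_all _ fun x => hlim' x j)
  refine ⟨Integrable.of_bound (aestronglyMeasurable_of_tendsto_ae atTop
      (fun N => (hS N).1.aestronglyMeasurable) (ae_of_all _ hlimω)) (∏ j, (C + C) ^ n j)
      (ae_of_all _ fun ω => le_of_tendsto (hlimω ω).norm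
        (Eventually.of_forall fun N => hbdω N ω)), ?_⟩
  have hlimP := tendsto_integral_of_dominated_convergence (fun _ => ∏ j, (C + C) ^ n j)
    (fun N => (hS N).1.aestronglyMeasurable) (integrable_const _)
    (fun N => ae_of_all P fun ω => hbdω N ω) (ae_of_all _ hlimω)
  refine tendsto_nhds_unique hlimP ?_
  simp_rw [fun N => (hS N).2]
  refine (tendsto_Z n fun h => ?_).const_mul _
  refine tendsto_integral_of_dominated_convergence (fun _ => ∏ j, (C + C) ^ h j)
    (fun N => ?_) (integrable_const _) (fun N => ae_of_all _ fun x => ?_)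
    (ae_of_all _ fun x => tendsto_finsetProd _ fun j _ => (hlim' x j).pow _)
  · exact (Finset.measurable_prod _ fun j _ => (hmeas N j).pow_const _).aestronglyMeasurable
  · rw [Real.norm_eq_abs, Finset.abs_prod]
    refine Finset.prod_le_prod (fun _ _ => abs_nonneg _) fun j _ => ?_
    rw [abs_pow]
    exact pow_le_pow_left₀ (abs_nonneg _) (hbd N x j) _

end RandomMeasure

end DirichletFergusonMoments

end

theorem mainTheorem7 {X : Type*} [TopologicalSpace X] [SecondCountableTopology X]
    [LocallyCompactSpace X] [T2Space X] [MeasurableSpace X] [BorelSpace X]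
    (β : ℝ) (hβ : 0 < β) (σ : ProbabilityMeasure X) (α : Measure X)
    (hα : α = ENNReal.ofReal β • (σ : Measure X))
    (D : @Measure (ProbabilityMeasure X) (borel (ProbabilityMeasure X)))
    (hD : DirichletFergusonMoments.IsDirichletFerguson α D)
    (q : ℕ) (n : Fin q → ℕ) (f : Fin q → X →ᵇ ℝ) :
    Integrable (fun η : ProbabilityMeasure X => ∏ j, (∫ x, f j x ∂(η : Measure X)) ^ n j) D ∧
    ∫ η : ProbabilityMeasure X, ∏ j, (∫ x, f j x ∂(η : Measure X)) ^ n j ∂D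
      = (DirichletFergusonMoments.multiFactorial n : ℝ)
          / DirichletFergusonMoments.pochhammer β (DirichletFergusonMoments.length n)
        * DirichletFergusonMoments.Z n (DirichletFergusonMoments.Omega f α) := by
  have hfin : IsFiniteMeasure α := by
    rw [hα]
    exact Measure.smul_finite _ ENNReal.ofReal_ne_top
  have huniv : α.real Set.univ = β := by
    simp [hα, hβ.le]
  have hf : Measurable fun (x : X) (j : Fin q) => f j x :=
    measurable_pi_lambda _ fun j => (f j).continuous.measurable
  have hC (x : X) : ‖fun j => f j x‖ ≤ ∑ j, ‖f j‖ := by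
    refine (pi_norm_le_iff_of_nonneg (Finset.sum_nonneg fun j _ => norm_nonneg _)).mpr fun j => ?_
    exact ((f j).norm_coe_le_norm x).trans
      (Finset.single_le_sum (f := fun j => ‖f j‖) (fun _ _ => norm_nonneg _) (Finset.mem_univ j))
  obtain ⟨hprob, hlaw⟩ := hD
  have h := @DirichletFergusonMoments.integrable_integral_prod_of_bounded X _ q
    (ProbabilityMeasure X) (borel (ProbabilityMeasure X)) D id α _ hprob hlaw
    (huniv ▸ hβ) _ hf _ hC n
  rw [huniv] at h
  exact h
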